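/- Let $F(x)=\cosh x-1$, $G(y)=\cosh y-1$ and $H(x,y)=F(x)+G(y)=\cosh x+\cosh y-2$. The associated Hamiltonian system $x'=G'(y)$, $y'=-F'(x)$ is $$x'=\sinh y,\qquad y'=-\sinh x .$$ The origin is a global center: every point of $\mathbb R^2\setminus\{(0,0)\}$ lies on a nonconstant periodic orbit. For every $E>0$ the level set $\{H=E\}$ is a single periodic orbit; let $T(E)$ denote its minimal period. Put $\Omega(E)=\{(x,y)\in\mathbb R^2: 0\le H(x,y)\le E\}$ and $$\begin{aligned}M(x,y)={}&\bigl[6F(x)F''(x)^2-3F'(x)^2F''(x)-2F(x)F'(x)F'''(x)\bigr]\,G(y)\,G'(y)^2\\&+F(x)F'(x)^2F''(x)\bigl[G'(y)^2-2G(y)G''(y)\bigr].\end{aligned}$$ Then for all $(x,y)\in\mathbb R^2$ $$M(x,y)=-(\cosh x-1)^2(\cosh y-1)^2\bigl(\cosh^2x-\cosh x\cosh y+2\cosh y+2\bigr),$$ and $E_0=4+4\sqrt3$ is the largest $E>0$ such that $M\le 0$ on $\Omega(E)$. Moreover, the period function $T$ is decreasing on $(0,4+4\sqrt3]$: it is differentiable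 with $T'(E)\le 0$ at every $E\in(0,4+4\sqrt3]$, and it is strictly decreasing on this interval. -/

import Mathlib

noncomputable section

/-- The separable Hamiltonian `H(x, y) = F(x) + G(y)`. -/
def separableHamiltonian (F G : ℝ → ℝ) (p : ℝ × ℝ) : ℝ := F p.1 + G p.2

/-- The Hamiltonian vector field `x' = G'(y)`, `y' = -F'(x)` of `H(x, y) = F(x) + G(y)`. -/
def hamiltonianField (F G : ℝ → ℝ) (p : ℝ × ℝ) : ℝ × ℝ := (deriv G p.2, -deriv F p.1)

/-- `O` is a (nonconstant) periodic orbit of the autonomous field `X`, with minimal period `τ`.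
A constant curve has no least positive period, so equilibria are excluded. -/
def IsPeriodicOrbitWithMinimalPeriod (X : ℝ × ℝ → ℝ × ℝ) (O : Set (ℝ × ℝ)) (τ : ℝ) : Prop :=
  ∃ γ : ℝ → ℝ × ℝ, IsIntegralCurve γ (fun _ => X) ∧ Set.range γ = O ∧
    IsLeast {s : ℝ | 0 < s ∧ Function.Periodic γ s} τ

/-- `O` is a (nonconstant) periodic orbit of `X`. -/
def IsPeriodicOrbit (X : ℝ × ℝ → ℝ × ℝ) (O : Set (ℝ × ℝ)) : Prop :=
  ∃ τ : ℝ, IsPeriodicOrbitWithMinimalPeriod X O τ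

/-- The period annulus of `X` at the point `c` (with `c` itself included): the largest connected
open neighbourhood of `c` that is, apart from `c`, entirely filled with periodic orbits. -/
def periodAnnulus (X : ℝ × ℝ → ℝ × ℝ) (c : ℝ × ℝ) : Set (ℝ × ℝ) :=
  ⋃₀ {U : Set (ℝ × ℝ) | IsOpen U ∧ IsConnected U ∧ c ∈ U ∧
    ∀ p ∈ U, p ≠ c → ∃ O : Set (ℝ × ℝ), IsPeriodicOrbit X O ∧ p ∈ O ∧ O ⊆ U}

/-- The period function of the center of `H(x, y) = F(x) + G(y)` at the origin: `T(E)` is the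
minimal period of the periodic orbit of energy `E` that lies in the period annulus. -/
def periodFunction (F G : ℝ → ℝ) (E : ℝ) : ℝ :=
  sInf {τ : ℝ | ∃ O : Set (ℝ × ℝ), O ⊆ periodAnnulus (hamiltonianField F G) (0, 0) ∧
    (∀ p ∈ O, separableHamiltonian F G p = E) ∧
    IsPeriodicOrbitWithMinimalPeriod (hamiltonianField F G) O τ}

/-- `Ω(E) = {(x, y) : 0 ≤ H(x, y) ≤ E}`. -/
def energyRegion (F G : ℝ → ℝ) (E : ℝ) : Set (ℝ × ℝ) :=
  {p | 0 ≤ separableHamiltonian F G p ∧ separableHamiltonian F G p ≤ E}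

/-- The function
`M = [6 F F''² - 3 F'² F'' - 2 F F' F'''] G G'² + F F'² F'' [G'² - 2 G G'']`. -/
def monotonicityFunction (F G : ℝ → ℝ) (x y : ℝ) : ℝ :=
  (6 * F x * (iteratedDeriv 2 F x) ^ 2 - 3 * (deriv F x) ^ 2 * iteratedDeriv 2 F x
      - 2 * F x * deriv F x * iteratedDeriv 3 F x) * (G y * (deriv G y) ^ 2)
    + F x * (deriv F x) ^ 2 * iteratedDeriv 2 F x * ((deriv G y) ^ 2 - 2 * G y * iteratedDeriv 2 G y)

end

/-! With `E = 2 * a`, the half-angle identity turns `H = E` into the circle `sinh² (x/2) + sinh²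
(y/2) = a`. In its angle `φ` the flow is `φ' = √(1 + a + a² sin² φ cos² φ)`, so `T(E)` is the
integral of `1 / √(1 + a + a² sin² φ cos² φ)` over one turn (`exists_levelCurve`,
`minimalPeriod_eq`). This integrand strictly decreases in `a`, so `T` decreases on all of `(0, ∞)`;
the sign of `M` plays no part in this.

The sign of `M` is that of a polynomial in `cosh x`, `cosh y`, which on the line `H = 4 + 4√3`
becomes `2 (cosh x - 2 - √3)²`; its double root makes this energy extremal. -/

/-! ### Angle and time along an orbit -/

/-- The squared angular speed of the flow of `cosh x + cosh y - 2 = 2 * a` in the angle `φ`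
given by `sinh (x / 2) = √a * sin φ`, `sinh (y / 2) = √a * cos φ`. -/
noncomputable def speedSq (a φ : ℝ) : ℝ := 1 + a + a ^ 2 * (Real.sin φ * Real.cos φ) ^ 2

theorem one_lt_speedSq {a : ℝ} (ha : 0 < a) (φ : ℝ) : 1 < speedSq a φ := by
  unfold speedSq
  nlinarith [sq_nonneg (a * (Real.sin φ * Real.cos φ))]

theorem speedSq_pos {a : ℝ} (ha : 0 < a) (φ : ℝ) : 0 < speedSq a φ :=
  zero_lt_one.trans (one_lt_speedSq ha φ)

theorem speedSq_add_two_pi (a φ : ℝ) : speedSq a (φ + 2 * Real.pi) = speedSq a φ := by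
  simp [speedSq]

theorem continuous_speedSq (a : ℝ) : Continuous (speedSq a) := by
  unfold speedSq
  fun_prop

/-- The reciprocal of the angular speed. -/
noncomputable def invSpeed (a φ : ℝ) : ℝ := (√(speedSq a φ))⁻¹

theorem invSpeed_pos {a : ℝ} (ha : 0 < a) (φ : ℝ) : 0 < invSpeed a φ :=
  inv_pos.2 (Real.sqrt_pos.2 (speedSq_pos ha φ))

theorem continuous_invSpeed {a : ℝ} (ha : 0 < a) : Continuous (invSpeed a) :=
  (continuous_speedSq a).sqrt.inv₀ fun φ => (Real.sqrt_pos.2 (speedSq_pos ha φ)).ne'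

theorem invSpeed_periodic (a : ℝ) : Function.Periodic (invSpeed a) (2 * Real.pi) := fun φ => by
  simp only [invSpeed, speedSq_add_two_pi]

/-- The time the flow needs to turn from the angle `0` to the angle `φ`. -/
noncomputable def angleTime (a φ : ℝ) : ℝ := ∫ s in (0 : ℝ)..φ, invSpeed a s

theorem hasDerivAt_angleTime {a : ℝ} (ha : 0 < a) (φ : ℝ) :
    HasDerivAt (angleTime a) (invSpeed a φ) φ :=
  intervalIntegral.integral_hasDerivAt_right ((continuous_invSpeed ha).intervalIntegrable _ _)
    ((continuous_invSpeed ha).stronglyMeasurableAtFilter _ _) (continuous_invSpeed ha).continuousAt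

theorem strictMono_angleTime {a : ℝ} (ha : 0 < a) : StrictMono (angleTime a) :=
  strictMono_of_deriv_pos fun φ => by
    rw [(hasDerivAt_angleTime ha φ).deriv]
    exact invSpeed_pos ha φ

theorem angleTime_zero (a : ℝ) : angleTime a 0 = 0 := by simp [angleTime]

theorem angleTime_two_pi_pos {a : ℝ} (ha : 0 < a) : 0 < angleTime a (2 * Real.pi) := by
  have := strictMono_angleTime ha Real.two_pi_pos
  rwa [angleTime_zero] at this

theorem angleTime_add_two_pi {a : ℝ} (ha : 0 < a) (φ : ℝ) :
    angleTime a (φ + 2 * Real.pi) = angleTime a φ + angleTime a (2 * Real.pi) := by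
  have h := (invSpeed_periodic a).intervalIntegral_add_eq_add 0 φ
    fun _ _ => (continuous_invSpeed ha).intervalIntegrable _ _
  simpa [angleTime] using h

theorem angleTime_int_mul {a : ℝ} (ha : 0 < a) (n : ℤ) :
    angleTime a (n * (2 * Real.pi)) = n * angleTime a (2 * Real.pi) := by
  have h := (invSpeed_periodic a).intervalIntegral_add_zsmul_eq n 0
    fun _ _ => (continuous_invSpeed ha).intervalIntegrable _ _
  simpa [angleTime] using h

theorem surjective_angleTime {a : ℝ} (ha : 0 < a) : Function.Surjective (angleTime a) := by
  intro t
  have hT := angleTime_two_pi_pos ha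
  have hc : Continuous (angleTime a) :=
    continuous_iff_continuousAt.2 fun φ => (hasDerivAt_angleTime ha φ).continuousAt
  refine mem_range_of_exists_le_of_exists_ge hc
    ⟨(⌊t / angleTime a (2 * Real.pi)⌋ : ℤ) * (2 * Real.pi), ?_⟩
    ⟨(⌈t / angleTime a (2 * Real.pi)⌉ : ℤ) * (2 * Real.pi), ?_⟩
  · rw [angleTime_int_mul ha, ← le_div_iff₀ hT]
    exact Int.floor_le _
  · rw [angleTime_int_mul ha, ← div_le_iff₀ hT]
    exact Int.le_ceil _

/-- Separation of variables: inverting the time integral solves the angle equation for all times. -/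
theorem exists_angle {a : ℝ} (ha : 0 < a) : ∃ φ : ℝ → ℝ, Function.LeftInverse φ (angleTime a) ∧
    Function.RightInverse φ (angleTime a) ∧ ∀ t, HasDerivAt φ (√(speedSq a (φ t))) t := by
  let e := (strictMono_angleTime ha).orderIsoOfSurjective _ (surjective_angleTime ha)
  have hr : ∀ t, angleTime a (e.symm t) = t := e.apply_symm_apply
  refine ⟨e.symm, e.symm_apply_apply, hr, fun t => ?_⟩
  have h := HasDerivAt.of_local_left_inverse e.symm.continuous.continuousAt
    (hasDerivAt_angleTime ha (e.symm t)) (invSpeed_pos ha _).ne' (Filter.Eventually.of_forall hr)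
  simpa [invSpeed] using h

/-! ### Parametrization of the level sets -/

theorem cosh_two_mul_arsinh (u : ℝ) : Real.cosh (2 * Real.arsinh u) = 1 + 2 * u ^ 2 := by
  rw [Real.cosh_two_mul, Real.cosh_sq, Real.sinh_arsinh]
  ring

theorem sinh_two_mul_arsinh (u : ℝ) :
    Real.sinh (2 * Real.arsinh u) = 2 * u * √(1 + u ^ 2) := by
  rw [Real.sinh_two_mul, Real.sinh_arsinh, Real.cosh_arsinh]

theorem exists_sin_cos_of_sq_add_sq {u v a : ℝ} (h : u ^ 2 + v ^ 2 = a) :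
    ∃ φ : ℝ, √a * Real.sin φ = u ∧ √a * Real.cos φ = v := by
  have hn : ‖(⟨v, u⟩ : ℂ)‖ = √a := by
    rw [Complex.norm_def, Complex.normSq_mk, ← h]
    ring_nf
  refine ⟨Complex.arg ⟨v, u⟩, ?_, ?_⟩
  · simpa [hn] using Complex.norm_mul_sin_arg ⟨v, u⟩
  · simpa [hn] using Complex.norm_mul_cos_arg ⟨v, u⟩

/-- The point of the level `cosh x + cosh y - 2 = 2 * a` at the angle `φ`. -/
noncomputable def levelPoint (a φ : ℝ) : ℝ × ℝ :=
  (2 * Real.arsinh (√a * Real.sin φ), 2 * Real.arsinh (√a * Real.cos φ))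

theorem range_levelPoint {a : ℝ} (ha : 0 < a) :
    Set.range (levelPoint a) = {p : ℝ × ℝ | Real.cosh p.1 + Real.cosh p.2 - 2 = 2 * a} := by
  ext ⟨x, y⟩
  constructor
  · rintro ⟨φ, h⟩
    obtain ⟨rfl, rfl⟩ := Prod.mk.inj h
    simp only [Set.mem_ofPred_eq, cosh_two_mul_arsinh, mul_pow, Real.sq_sqrt ha.le]
    linear_combination 2 * a * Real.sin_sq_add_cos_sq φ
  · intro h
    have hx := Real.cosh_two_mul (x / 2)
    have hy := Real.cosh_two_mul (y / 2)
    rw [Real.cosh_sq, mul_div_cancel₀ _ two_ne_zero] at hx hy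
    simp only [Set.mem_ofPred_eq] at h
    obtain ⟨φ, h₁, h₂⟩ := exists_sin_cos_of_sq_add_sq (u := Real.sinh (x / 2))
      (a := a) (v := Real.sinh (y / 2)) (by linarith)
    refine ⟨φ, ?_⟩
    simp only [levelPoint, h₁, h₂, Real.arsinh_sinh]
    ext <;> simp only <;> ring

theorem levelPoint_periodic (a : ℝ) : Function.Periodic (levelPoint a) (2 * Real.pi) := fun φ => by
  simp [levelPoint]

/-- The second coordinate alone forces `cos φ = 1`. -/
theorem exists_int_of_levelPoint_eq {a φ : ℝ} (ha : 0 < a) (h : levelPoint a φ = levelPoint a 0) :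
    ∃ n : ℤ, (n : ℝ) * (2 * Real.pi) = φ := by
  rw [← Real.cos_eq_one_iff]
  have h₂ := (Prod.mk.inj h).2
  have h₃ := Real.arsinh_injective (mul_left_cancel₀ two_ne_zero h₂)
  simpa using mul_left_cancel₀ (Real.sqrt_pos.2 ha).ne' h₃

theorem one_add_sq_mul_one_add_sq {a : ℝ} (ha : 0 < a) (φ : ℝ) :
    √(1 + (√a * Real.sin φ) ^ 2) * √(1 + (√a * Real.cos φ) ^ 2) = √(speedSq a φ) := by
  rw [← Real.sqrt_mul (by positivity), speedSq]
  congr 1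
  simp only [mul_pow, Real.sq_sqrt ha.le]
  linear_combination a * Real.sin_sq_add_cos_sq φ

theorem hasDerivAt_levelPoint {a t : ℝ} {φ : ℝ → ℝ} (ha : 0 < a)
    (hφ : HasDerivAt φ (√(speedSq a (φ t))) t) :
    HasDerivAt (fun t => levelPoint a (φ t))
      (Real.sinh (levelPoint a (φ t)).2, -Real.sinh (levelPoint a (φ t)).1) t := by
  have hs := (((hφ.sin.const_mul (√a)).arsinh).const_mul 2)
  have hc := (((hφ.cos.const_mul (√a)).arsinh).const_mul 2)
  have hs0 : 0 < √(1 + (√a * Real.sin (φ t)) ^ 2) := by positivity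
  have hc0 : 0 < √(1 + (√a * Real.cos (φ t)) ^ 2) := by positivity
  rw [← one_add_sq_mul_one_add_sq ha] at hs hc
  refine (hs.prodMk hc).congr_deriv ?_
  simp only [levelPoint, sinh_two_mul_arsinh, smul_eq_mul, Prod.mk.injEq]
  constructor <;> field_simp

/-- The Hamiltonian field of `cosh x + cosh y - 2`. -/
noncomputable def sinhField (p : ℝ × ℝ) : ℝ × ℝ := (Real.sinh p.2, -Real.sinh p.1)

theorem exists_levelCurve {a : ℝ} (ha : 0 < a) : ∃ γ : ℝ → ℝ × ℝ,
    IsIntegralCurve γ (fun _ => sinhField) ∧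
    Set.range γ = {p : ℝ × ℝ | Real.cosh p.1 + Real.cosh p.2 - 2 = 2 * a} ∧
    IsLeast {s : ℝ | 0 < s ∧ Function.Periodic γ s} (angleTime a (2 * Real.pi)) := by
  obtain ⟨φ, hl, hr, hφ⟩ := exists_angle ha
  have hT := angleTime_two_pi_pos ha
  refine ⟨fun t => levelPoint a (φ t), fun t => hasDerivAt_levelPoint ha (hφ t), ?_,
    ⟨hT, fun t => ?_⟩, ?_⟩
  · rw [← range_levelPoint ha]
    exact hl.surjective.range_comp (levelPoint a)
  · have : φ (t + angleTime a (2 * Real.pi)) = φ t + 2 * Real.pi := by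
      rw [← hl (φ t + 2 * Real.pi), angleTime_add_two_pi ha, hr]
    simp only [this, levelPoint_periodic a (φ t)]
  -- A period `s` brings the angle from `0` to some `2πn`, so `s` is `n` times the full-turn time,
  -- with `n ≥ 1` since `s > 0`.
  · rintro s ⟨hs, hp⟩
    have h0 : φ 0 = 0 := by simpa [angleTime_zero] using hl 0
    have h := hp 0
    simp only [zero_add, h0] at h
    obtain ⟨n, hn⟩ := exists_int_of_levelPoint_eq ha h
    have hs' : (n : ℝ) * angleTime a (2 * Real.pi) = s := by
      rw [← angleTime_int_mul ha, hn, hr]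
    have hn0 : (0 : ℝ) < n := pos_of_mul_pos_left (hs'.symm ▸ hs) hT.le
    have hn1 : (1 : ℝ) ≤ n := by exact_mod_cast Int.add_one_le_iff.2 (Int.cast_pos.1 hn0)
    rw [← hs']
    exact le_mul_of_one_le_left hT.le hn1

/-! ### Uniqueness of the orbit on a level -/

theorem contDiff_sinhField : ContDiff ℝ 1 sinhField := by
  unfold sinhField
  fun_prop

/-- The field is not globally Lipschitz, but each level lies in a compact convex box, where it is.
-/
theorem integralCurve_unique_on_level {a : ℝ} {γ δ : ℝ → ℝ × ℝ}
    (hγ : IsIntegralCurve γ (fun _ => sinhField)) (hδ : IsIntegralCurve δ (fun _ => sinhField))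
    (hγa : ∀ t, Real.cosh (γ t).1 + Real.cosh (γ t).2 - 2 = 2 * a)
    (hδa : ∀ t, Real.cosh (δ t).1 + Real.cosh (δ t).2 - 2 = 2 * a) (h0 : γ 0 = δ 0) : γ = δ := by
  set R := |Real.arcosh (2 * a + 1)|
  have ha : 1 ≤ 2 * a + 1 := by
    linarith [hγa 0, Real.one_le_cosh (γ 0).1, Real.one_le_cosh (γ 0).2]
  have key : ∀ p : ℝ × ℝ, Real.cosh p.1 + Real.cosh p.2 - 2 = 2 * a →
      p ∈ Set.Icc ((-R, -R) : ℝ × ℝ) (R, R) := by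
    intro p hp
    have h₁ : |p.1| ≤ R := by
      rw [← Real.cosh_le_cosh, Real.cosh_arcosh ha]
      linarith [Real.one_le_cosh p.2]
    have h₂ : |p.2| ≤ R := by
      rw [← Real.cosh_le_cosh, Real.cosh_arcosh ha]
      linarith [Real.one_le_cosh p.1]
    rw [abs_le] at h₁ h₂
    exact ⟨⟨h₁.1, h₂.1⟩, ⟨h₁.2, h₂.2⟩⟩
  obtain ⟨K, hK⟩ := (contDiff_sinhField.contDiffOn).exists_lipschitzOnWith one_ne_zero
    (convex_Icc ((-R, -R) : ℝ × ℝ) (R, R)) isCompact_Icc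
  exact ODE_solution_unique_univ (v := fun _ => sinhField)
    (s := fun _ => Set.Icc ((-R, -R) : ℝ × ℝ) (R, R)) (fun _ => hK)
    (fun t => ⟨hγ t, key _ (hγa t)⟩) (fun t => ⟨hδ t, key _ (hδa t)⟩) h0

/-- By uniqueness, any orbit inside the level is a time shift of the explicit curve, hence has the
same periods. -/
theorem minimalPeriod_eq {a τ : ℝ} (ha : 0 < a) {O : Set (ℝ × ℝ)}
    (hO : ∀ p ∈ O, Real.cosh p.1 + Real.cosh p.2 - 2 = 2 * a)
    (h : IsPeriodicOrbitWithMinimalPeriod sinhField O τ) : τ = angleTime a (2 * Real.pi) := by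
  obtain ⟨δ, hδ, rfl, hτ⟩ := h
  obtain ⟨γ, hγ, hr, hT⟩ := exists_levelCurve ha
  have hδa : ∀ t, Real.cosh (δ t).1 + Real.cosh (δ t).2 - 2 = 2 * a := fun t => hO _ ⟨t, rfl⟩
  have hγa : ∀ t, Real.cosh (γ t).1 + Real.cosh (γ t).2 - 2 = 2 * a := fun t => by
    have : γ t ∈ Set.range γ := ⟨t, rfl⟩
    rwa [hr] at this
  obtain ⟨t₀, ht₀⟩ : δ 0 ∈ Set.range γ := by rw [hr]; exact hδa 0
  have hshift : (fun t => γ (t + t₀)) = δ :=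
    integralCurve_unique_on_level (fun t => (hγ (t + t₀)).comp_add_const t t₀) hδ
      (fun t => hγa _) hδa (by simpa using ht₀)
  have hper : ∀ s, Function.Periodic δ s ↔ Function.Periodic γ s := by
    intro s
    rw [← hshift]
    refine ⟨fun h t => ?_, fun h t => ?_⟩
    · have := h (t - t₀)
      simp only [sub_add_cancel] at this
      rw [← this]
      ring_nf
    · simp only
      rw [← h (t + t₀)]
      ring_nf
  simp only [hper] at hτ
  exact hτ.unique hT

/-! ### Dependence of the period on the energy -/

theorem hasDerivAt_invSpeed {a : ℝ} (ha : 0 < a) (φ : ℝ) :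
    HasDerivAt (fun a => invSpeed a φ)
      (-(1 + 2 * a * (Real.sin φ * Real.cos φ) ^ 2) / (2 * √(speedSq a φ)) / speedSq a φ) a := by
  have h1 : HasDerivAt (fun a => speedSq a φ) (1 + 2 * a * (Real.sin φ * Real.cos φ) ^ 2) a := by
    have := ((hasDerivAt_id a).const_add 1).add
      (((hasDerivAt_id a).pow 2).mul_const ((Real.sin φ * Real.cos φ) ^ 2))
    refine this.congr_deriv ?_
    simp
  have hp := speedSq_pos ha φ
  refine ((h1.sqrt hp.ne').inv (Real.sqrt_pos.2 hp).ne').congr_deriv ?_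
  rw [Real.sq_sqrt hp.le]
  ring

theorem differentiableAt_angleTime_two_pi {a : ℝ} (ha : 0 < a) :
    DifferentiableAt ℝ (fun a => angleTime a (2 * Real.pi)) a := by
  have hs : Set.Ioo 0 (a + 1) ∈ nhds a := Ioo_mem_nhds ha (lt_add_one a)
  refine (intervalIntegral.hasDerivAt_integral_of_dominated_loc_of_deriv_le
    -- For `0 < b < a + 1` the numerator is at most `1 + 2 * b` and the denominators are at least
    -- `1`.
    (bound := fun _ => 1 + 2 * (a + 1))
    (F' := fun a φ =>
      -(1 + 2 * a * (Real.sin φ * Real.cos φ) ^ 2) / (2 * √(speedSq a φ)) / speedSq a φ)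
    hs ?_ ((continuous_invSpeed ha).intervalIntegrable _ _) ?_ ?_ (by simp) ?_).2.differentiableAt
  · filter_upwards [hs] with b hb
    exact (continuous_invSpeed hb.1).aestronglyMeasurable
  · refine Continuous.aestronglyMeasurable ?_
    have := continuous_speedSq a
    refine ((by fun_prop : Continuous _).div₀ (by fun_prop) fun φ => ?_).div₀ this fun φ => ?_
    · exact (mul_pos two_pos (Real.sqrt_pos.2 (speedSq_pos ha φ))).ne'
    · exact (speedSq_pos ha φ).ne'
  · refine Filter.Eventually.of_forall fun φ _ b hb => ?_
    have h1 := (one_lt_speedSq hb.1 φ).le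
    have h2 : 1 ≤ √(speedSq b φ) := Real.one_le_sqrt.2 h1
    have h3 : (Real.sin φ * Real.cos φ) ^ 2 ≤ 1 := by
      rw [mul_pow]
      exact mul_le_one₀ (Real.sin_sq_le_one φ) (sq_nonneg _) (Real.cos_sq_le_one φ)
    have h0 : 0 < b := hb.1
    have h4 : 0 ≤ 1 + 2 * b * (Real.sin φ * Real.cos φ) ^ 2 := by positivity
    rw [div_div, norm_div, norm_neg, Real.norm_of_nonneg h4, Real.norm_of_nonneg (by positivity)]
    refine (div_le_self h4 ?_).trans ?_
    · exact one_le_mul_of_one_le_of_one_le (by linarith) h1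
    · have := mul_le_of_le_one_right h0.le h3
      linarith [hb.2]
  · exact Filter.Eventually.of_forall fun φ _ b hb => hasDerivAt_invSpeed hb.1 φ

theorem strictAntiOn_invSpeed (φ : ℝ) : StrictAntiOn (fun a => invSpeed a φ) (Set.Ioi 0) := by
  intro a ha b hb hab
  have ha : 0 < a := ha
  refine inv_strictAnti₀ (Real.sqrt_pos.2 (speedSq_pos ha φ))
    (Real.sqrt_lt_sqrt (speedSq_pos ha φ).le ?_)
  unfold speedSq
  have : a ^ 2 * (Real.sin φ * Real.cos φ) ^ 2 ≤ b ^ 2 * (Real.sin φ * Real.cos φ) ^ 2 := by gcongr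
  linarith

theorem strictAntiOn_angleTime_two_pi :
    StrictAntiOn (fun a => angleTime a (2 * Real.pi)) (Set.Ioi 0) := by
  intro a ha b hb hab
  exact intervalIntegral.integral_lt_integral_of_continuousOn_of_le_of_exists_lt Real.two_pi_pos
    (continuous_invSpeed hb).continuousOn (continuous_invSpeed ha).continuousOn
    (fun φ _ => (strictAntiOn_invSpeed φ ha hb hab).le)
    -- By continuity, strictness at a single angle suffices.
    ⟨0, Set.left_mem_Icc.2 Real.two_pi_pos.le, strictAntiOn_invSpeed 0 ha hb hab⟩

/-! ### The system in terms of `cosh` and `sinh` -/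

theorem separableHamiltonian_cosh (p : ℝ × ℝ) :
    separableHamiltonian (fun x => Real.cosh x - 1) (fun y => Real.cosh y - 1) p =
      Real.cosh p.1 + Real.cosh p.2 - 2 := by
  simp only [separableHamiltonian]
  ring

theorem deriv_cosh_sub_one : deriv (fun x => Real.cosh x - 1) = Real.sinh := by
  funext x
  simp

theorem iteratedDeriv_two_cosh_sub_one :
    iteratedDeriv 2 (fun x => Real.cosh x - 1) = Real.cosh := by
  rw [iteratedDeriv_succ, iteratedDeriv_one, deriv_cosh_sub_one, Real.deriv_sinh]

theorem iteratedDeriv_three_cosh_sub_one :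
    iteratedDeriv 3 (fun x => Real.cosh x - 1) = Real.sinh := by
  rw [iteratedDeriv_succ, iteratedDeriv_two_cosh_sub_one, Real.deriv_cosh]

theorem hamiltonianField_cosh :
    hamiltonianField (fun x => Real.cosh x - 1) (fun y => Real.cosh y - 1) = sinhField := by
  funext p
  simp only [hamiltonianField, deriv_cosh_sub_one, sinhField]

theorem exists_periodicOrbit_level {E : ℝ} (hE : 0 < E) :
    IsPeriodicOrbitWithMinimalPeriod sinhField
      {p : ℝ × ℝ | Real.cosh p.1 + Real.cosh p.2 - 2 = E} (angleTime (E / 2) (2 * Real.pi)) := by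
  have h := exists_levelCurve (half_pos hE)
  rwa [mul_div_cancel₀ _ two_ne_zero] at h

theorem periodAnnulus_sinhField : periodAnnulus sinhField (0, 0) = Set.univ := by
  refine Set.eq_univ_of_forall fun q => ⟨Set.univ, ⟨isOpen_univ, isConnected_univ, trivial,
    fun p _ hp => ?_⟩, trivial⟩
  have hE : 0 < Real.cosh p.1 + Real.cosh p.2 - 2 := by
    have h1 := Real.one_le_cosh p.1
    have h2 := Real.one_le_cosh p.2
    by_cases h : p.1 = 0
    · have : p.2 ≠ 0 := fun h' => hp (Prod.ext h h')
      linarith [Real.one_lt_cosh.2 this]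
    · linarith [Real.one_lt_cosh.2 h]
  exact ⟨_, ⟨_, exists_periodicOrbit_level hE⟩, rfl, Set.subset_univ _⟩

theorem periodFunction_cosh {E : ℝ} (hE : 0 < E) :
    periodFunction (fun x => Real.cosh x - 1) (fun y => Real.cosh y - 1) E =
      angleTime (E / 2) (2 * Real.pi) := by
  unfold periodFunction
  simp only [hamiltonianField_cosh, separableHamiltonian_cosh, periodAnnulus_sinhField]
  rw [← csInf_singleton (angleTime (E / 2) (2 * Real.pi))]
  congr 1
  ext τ
  constructor
  · rintro ⟨O, -, hO, h⟩
    refine minimalPeriod_eq (half_pos hE) (fun p hp => ?_) h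
    rw [hO p hp]
    ring
  · rintro rfl
    exact ⟨_, Set.subset_univ _, fun _ hp => hp, exists_periodicOrbit_level hE⟩

theorem monotonicityFunction_cosh (x y : ℝ) :
    monotonicityFunction (fun x => Real.cosh x - 1) (fun y => Real.cosh y - 1) x y =
      -(Real.cosh x - 1) ^ 2 * (Real.cosh y - 1) ^ 2 *
        (Real.cosh x ^ 2 - Real.cosh x * Real.cosh y + 2 * Real.cosh y + 2) := by
  simp only [monotonicityFunction, deriv_cosh_sub_one, iteratedDeriv_two_cosh_sub_one,
    iteratedDeriv_three_cosh_sub_one]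
  have hx := Real.sinh_sq x
  have hy := Real.sinh_sq y
  have h : 2 * (Real.cosh x - 1) * Real.sinh x * Real.sinh x =
      2 * (Real.cosh x - 1) * Real.sinh x ^ 2 := by ring
  rw [h, hx, hy]
  ring

/-! ### The sign of `M` and the theorem -/

/-- For `c ≤ 2` write it as `c² + 2 + (2 - c) d`; for `c ≥ 2` it equals `2 (c - 2 - √3)² + (c - 2)(6
+ 4√3 - c - d)`. -/
theorem quadratic_nonneg_of_add_le {c d : ℝ} (hc : 1 ≤ c) (hd : 1 ≤ d)
    (h : c + d - 2 ≤ 4 + 4 * √3) : 0 ≤ c ^ 2 - c * d + 2 * d + 2 := by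
  have h3 : √3 ^ 2 = 3 := Real.sq_sqrt (by norm_num)
  rcases le_total c 2 with h2 | h2
  · nlinarith
  · nlinarith [mul_nonneg (sub_nonneg.2 h2) (sub_nonneg.2 h), sq_nonneg (c - 2 - √3)]

/-- The left side is `-√3 (E - 4 - 4√3)`. -/
theorem quadratic_neg {E : ℝ} (hE : 4 + 4 * √3 < E) :
    (2 + √3) ^ 2 - (2 + √3) * (E - √3) + 2 * (E - √3) + 2 < 0 := by
  have h3 : √3 ^ 2 = 3 := Real.sq_sqrt (by norm_num)
  have : 0 < √3 := by positivity
  nlinarith [mul_pos this (sub_pos.2 hE)]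

theorem mainTheorem5 (F G : ℝ → ℝ) (hF : F = fun x => Real.cosh x - 1)
    (hG : G = fun y => Real.cosh y - 1) :
    -- the system `x' = sinh y`, `y' = -sinh x` is Hamiltonian with `H = cosh x + cosh y - 2`
    (∀ p : ℝ × ℝ, separableHamiltonian F G p = Real.cosh p.1 + Real.cosh p.2 - 2) ∧
    (∀ p : ℝ × ℝ, hamiltonianField F G p = (Real.sinh p.2, -Real.sinh p.1)) ∧
    -- the origin is a global center, and every level `H = E`, `E > 0`, is one periodic orbit,
    -- whose minimal period is `T(E)`
    periodAnnulus (hamiltonianField F G) (0, 0) = Set.univ ∧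
    (∀ E : ℝ, 0 < E → IsPeriodicOrbitWithMinimalPeriod (hamiltonianField F G)
      {p | separableHamiltonian F G p = E} (periodFunction F G E)) ∧
    -- factorization of `M`
    (∀ x y : ℝ, monotonicityFunction F G x y =
      -(Real.cosh x - 1) ^ 2 * (Real.cosh y - 1) ^ 2 *
        (Real.cosh x ^ 2 - Real.cosh x * Real.cosh y + 2 * Real.cosh y + 2)) ∧
    -- `4 + 4√3` is the largest energy `E` with `M ≤ 0` on `Ω(E)`
    IsGreatest {E : ℝ | 0 < E ∧ ∀ p ∈ energyRegion F G E, monotonicityFunction F G p.1 p.2 ≤ 0}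
      (4 + 4 * Real.sqrt 3) ∧
    -- `T` is decreasing, and strictly so, up to this energy
    (∀ E ∈ Set.Ioc (0 : ℝ) (4 + 4 * Real.sqrt 3),
      DifferentiableAt ℝ (periodFunction F G) E ∧ deriv (periodFunction F G) E ≤ 0) ∧
    StrictAntiOn (periodFunction F G) (Set.Ioc (0 : ℝ) (4 + 4 * Real.sqrt 3)) := by
  subst hF hG
  have hloc : ∀ E : ℝ, 0 < E →
      periodFunction (fun x => Real.cosh x - 1) (fun y => Real.cosh y - 1) =ᶠ[nhds E]
        fun E => angleTime (E / 2) (2 * Real.pi) := fun E hE => by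
    filter_upwards [Ioi_mem_nhds hE] with e he using periodFunction_cosh he
  have hanti : StrictAntiOn
      (periodFunction (fun x => Real.cosh x - 1) (fun y => Real.cosh y - 1)) (Set.Ioi 0) := by
    intro a ha b hb hab
    rw [periodFunction_cosh ha, periodFunction_cosh hb]
    exact strictAntiOn_angleTime_two_pi (half_pos (Set.mem_Ioi.1 ha)) (half_pos (Set.mem_Ioi.1 hb))
      (by linarith)
  refine ⟨separableHamiltonian_cosh, congrFun hamiltonianField_cosh, ?_, fun E hE => ?_,
    monotonicityFunction_cosh, ⟨⟨by positivity, fun p hp => ?_⟩, fun E hE => ?_⟩,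
    fun E hE => ⟨?_, ?_⟩, hanti.mono fun E hE => hE.1⟩
  · rw [hamiltonianField_cosh, periodAnnulus_sinhField]
  · rw [hamiltonianField_cosh, periodFunction_cosh hE]
    simpa only [separableHamiltonian_cosh] using exists_periodicOrbit_level hE
  · have h := hp.2
    rw [separableHamiltonian_cosh] at h
    have hq := quadratic_nonneg_of_add_le (Real.one_le_cosh p.1) (Real.one_le_cosh p.2) h
    rw [monotonicityFunction_cosh, neg_mul, neg_mul, neg_nonpos]
    positivity
  · by_contra hlt
    rw [not_le] at hlt
    have h3 : 0 < √3 := by positivity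
    -- The test point has `cosh x` at the double root `2 + √3`, and `cosh y = E - √3` puts it on `H
    -- = E`.
    have hx : Real.cosh (Real.arcosh (2 + √3)) = 2 + √3 := Real.cosh_arcosh (by linarith)
    have hy : Real.cosh (Real.arcosh (E - √3)) = E - √3 := Real.cosh_arcosh (by linarith)
    have h := hE.2 (Real.arcosh (2 + √3), Real.arcosh (E - √3)) (by
      simp only [energyRegion, Set.mem_ofPred_eq, separableHamiltonian_cosh, hx, hy]
      constructor <;> linarith [hE.1])
    rw [monotonicityFunction_cosh, hx, hy] at h
    have h1 : 0 < (2 + √3 - 1) ^ 2 := pow_pos (by linarith) 2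
    have h2 : 0 < (E - √3 - 1) ^ 2 := pow_pos (by linarith) 2
    have := mul_neg_of_pos_of_neg (mul_pos h1 h2) (quadratic_neg hlt)
    linarith
  · refine DifferentiableAt.congr_of_eventuallyEq ?_ (hloc E hE.1)
    exact (differentiableAt_angleTime_two_pi (half_pos hE.1)).fun_comp' E
      (differentiableAt_fun_id.div_const (2 : ℝ))
  -- Monotonicity on the open half-line also covers the endpoint `4 + 4√3`.
  · rw [← derivWithin_of_mem_nhds (Ioi_mem_nhds hE.1)]
    exact hanti.antitoneOn.derivWithin_nonpos
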